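/- Let $V$ be a finite linearly ordered set with $n$ elements, let $2^V$ be the $(n-1)$-dimensional simplex on the vertex set $V=\{v_1<\dots<v_n\}$, and let $r\ge 1$ be an integer. The $r$-th edgewise subdivision $(2^V)^{\langle r\rangle}$ is the simplicial complex whose vertices are the vectors $u\in\mathbb{N}^n$ with $u_1+\dots+u_n=r$, and in which a set $E$ of such vectors is a face if and only if for all $u,u'\in E$ one of $\iota(u)-\iota(u')$, $\iota(u')-\iota(u)$ lies in $\{0,1\}^n$, where $\iota(u)=(u_1,u_1+u_2,\dots,u_1+\dots+u_n)$. For $F\subseteq V$ let $(2^V)^{\langle r\rangle}_F$ be the subcomplex of the faces $E$ such that every $u\in E$ satisfies $u_i=0$ whenever $v_i\notin F$. For a simplicial complex $\Delta$ of dimension $d-1$ with $f_{k}$ faces of dimension $k$ (and $f_{-1}=1$) let $h(\Delta,x)=\sum_{k=0}^{d} f_{k-1}\,x^k(1-x)^{d-k}$. The local $h$-polynomial is $$\ell_V\big((2^V)^{\langle r\rangle},x\big)=\sum_{F\subseteq V}(-1)^{|V\setminus F|}\,h\big((2^V)^{\langle r\rangle}_F,x\big).$$ **Corollary 2.5.**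 The polynomial $\ell_V((2^V)^{\langle r\rangle},x)$ has only real zeros: it is identically zero or all of its complex zeros are real. This answers a question of Athanasiadis in the affirmative. -/

import Mathlib

open Polynomial

noncomputable section

/-- `d = dim Δ + 1`, the largest number of vertices of a face of the finite complex `Δ`. The empty
set is counted as a face, so that the empty complex has `d = 0`. -/
def topSize {W : Type*} (Δ : PreAbstractSimplicialComplex W) : ℕ :=
  sSup (Finset.card '' insert ∅ Δ.faces)

/-- The number `f_{k-1}` of faces of `Δ` with `k` vertices, that is, of dimension `k - 1`.
The empty set is counted as a face, so that `f_{-1} = 1`. -/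
def faceCount {W : Type*} (Δ : PreAbstractSimplicialComplex W) (k : ℕ) : ℕ :=
  {E : Finset W | E ∈ insert ∅ Δ.faces ∧ E.card = k}.ncard

/-- The `h`-polynomial `h(Δ, x) = ∑ hᵢ xⁱ = ∑ₖ f_{k-1} xᵏ (1 - x)^(d-k)` of a finite complex of
dimension `d - 1`. Replacing `x` by `1/x` and multiplying by `x^d` gives the relation
`∑ f_{k-1} (x - 1)^(d-k) = ∑ hᵢ x^(d-i)`. -/
def hPolynomial {W : Type*} (Δ : PreAbstractSimplicialComplex W) : ℝ[X] :=
  ∑ k ∈ Finset.range (topSize Δ + 1),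
    (faceCount Δ k : ℝ[X]) * X ^ k * (1 - X) ^ (topSize Δ - k)

/-- The restriction `Γ_F = {E ∈ Γ : σ(E) ⊆ F}`, where `σ` sends a face of the subdivision `Γ` to
its carrier. -/
def carrierRestrict {V W : Type*} (Γ : PreAbstractSimplicialComplex W)
    (σ : Finset W → Finset V) (hσ : Monotone σ) (F : Finset V) :
    PreAbstractSimplicialComplex W where
  faces := {E | E ∈ Γ.faces ∧ σ E ⊆ F}
  isRelLowerSet_faces := fun _ hE =>
    ⟨(Γ.isRelLowerSet_faces hE.1).1, fun _ hGE hG =>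
      ⟨(Γ.isRelLowerSet_faces hE.1).2 hGE hG, (hσ hGE).trans hE.2⟩⟩

/-- Stanley's local `h`-polynomial `ℓ_V(Γ, x) = ∑_{F ⊆ V} (-1)^|V ∖ F| h(Γ_F, x)` of a subdivision
`Γ` of the simplex `2^V` with carrier map `σ`. -/
def localHPolynomial {V W : Type*} [Fintype V] (Γ : PreAbstractSimplicialComplex W)
    (σ : Finset W → Finset V) (hσ : Monotone σ) : ℝ[X] :=
  ∑ F : Finset V, (-1) ^ (Fintype.card V - F.card) * hPolynomial (carrierRestrict Γ σ hσ F)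

/-- The simplex `2^V`: every nonempty subset of `V` is a face. -/
def simplex (V : Type*) : PreAbstractSimplicialComplex V := ⊤

section Edgewise

variable {V : Type*} [Fintype V] [LinearOrder V]

/-- The carrier of a set `E` of lattice points: the union of the supports of its elements. -/
def latticeCarrier (E : Finset (V → ℕ)) : Finset V :=
  E.sup fun u => Finset.univ.filter fun v => u v ≠ 0

theorem latticeCarrier_mono : Monotone (latticeCarrier (V := V)) :=
  fun _ _ h => Finset.sup_mono h

/-- The partial sums `ι(u) = (u₁, u₁ + u₂, …, u₁ + ⋯ + uₙ)`, for `V = {v₁ < ⋯ < vₙ}`. -/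
def partialSums (u : V → ℕ) (v : V) : ℕ := ∑ w ∈ Finset.univ.filter (· ≤ v), u w

/-- `ι(u') - ι(u)` has all its coordinates in `{0, 1}`. -/
def UnitStep (u u' : V → ℕ) : Prop :=
  ∀ v, partialSums u' v = partialSums u v ∨ partialSums u' v = partialSums u v + 1

/-- The `r`-th edgewise subdivision `Δ^⟨r⟩` of a complex `Δ` on the linearly ordered vertex set `V`.
Its vertices are the lattice points `u ∈ ℕ^V` with coordinate sum `r` and support in `Δ`
(the point `u` stands for the point with barycentric coordinates `u / r`); a set `E` of them is a
face if the union of the supports is a face of `Δ` and, for any two `u, u' ∈ E`, one of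
`ι(u') - ι(u)`, `ι(u) - ι(u')` lies in `{0, 1}^V`. -/
def edgewiseSubdivision (r : ℕ) (Δ : PreAbstractSimplicialComplex V) :
    PreAbstractSimplicialComplex (V → ℕ) where
  faces := {E | E.Nonempty ∧ (∀ u ∈ E, ∑ v, u v = r) ∧ latticeCarrier E ∈ Δ.faces ∧
    ∀ u ∈ E, ∀ u' ∈ E, UnitStep u u' ∨ UnitStep u' u}
  isRelLowerSet_faces := by
    rintro E ⟨hne, hsum, hcar, hstep⟩
    refine ⟨hne, fun G hGE hG => ⟨hG, fun u hu => hsum u (hGE hu), ?_,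
      fun u hu u' hu' => hstep u (hGE hu) u' (hGE hu')⟩⟩
    refine (Δ.isRelLowerSet_faces hcar).2 (latticeCarrier_mono hGE) ?_
    obtain ⟨v, hv⟩ := (Δ.isRelLowerSet_faces hcar).1
    obtain ⟨u, hu, huv⟩ := Finset.mem_sup.mp hv
    obtain ⟨g, hg⟩ := hG
    have hr : ∑ w, g w ≠ 0 := by
      rw [hsum g (hGE hg), ← hsum u hu]
      intro h0
      exact (Finset.mem_filter.mp huv).2 (Finset.sum_eq_zero_iff.mp h0 v (Finset.mem_univ v))
    obtain ⟨w, -, hw⟩ := Finset.exists_ne_zero_of_sum_ne_zero hr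
    exact ⟨w, Finset.mem_sup.mpr ⟨g, hg, Finset.mem_filter.mpr ⟨Finset.mem_univ w, hw⟩⟩⟩

/-- The local `h`-polynomial `ℓ_V((2^V)^⟨r⟩, x)`. -/
def edgewiseLocalHPolynomial (V : Type*) [Fintype V] [LinearOrder V] (r : ℕ) : ℝ[X] :=
  localHPolynomial (edgewiseSubdivision r (simplex V)) latticeCarrier latticeCarrier_mono

end Edgewise

/-- All complex zeros of `p` are real; the zero polynomial is included by convention. -/
def HasOnlyRealZeros (p : ℝ[X]) : Prop :=
  p = 0 ∨ ∀ z : ℂ, aeval z p = 0 → z.im = 0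

end

/-! By inclusion–exclusion over carriers, the local `h`-polynomial is the section `∑ c_{rk} x^k` of
`(x + ⋯ + x^(r-1))^n = ∑ c_j x^j` (`edgewiseLocalHPolynomial_eq`). This rests on the `h`-polynomial
of the part over `F` (`hPolynomial_carrierRestrict`): each lattice point of the `mr`-fold dilated
simplex is uniquely a sum of `m` vertices of one face (`card_weightedFaces`). The series `∑_E
(x/(1-x))^|E|` therefore counts these points, and division with remainder by `r` counts them again.

For the zeros, fix `y` in the open upper half plane. The value at `y` is obtained by applying
`windowSum r` `n` times to the sequence with `y^k` at `rk` and zero elsewhere, and reading off entry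
`0` (`aeval_edgewiseLocalHPolynomial`). Window sums keep the arguments rotating monotonically, by at
most a half turn per period (`RotatingSequence.windowSum`), and such a sum vanishes only if all its
terms do (`RotatingSequence.eq_zero_of_windowSum_eq_zero`). Hence no zero lies above the real axis,
and conjugation excludes those below. -/

noncomputable section

/-! ### Rotating sequences and their window sums -/

open ComplexConjugate in
/-- A quasi-periodic sequence of complex numbers, with multiplier `y`, whose arguments weakly
increase along each period, by at most a half turn. -/
structure RotatingSequence (r : ℕ) (y : ℂ) (w : ℕ → ℂ) : Prop where
  quasiperiodic : ∀ j, w (j + r) = y * w j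
  cross_nonneg : ∀ j i, j ≤ i → i ≤ j + r → 0 ≤ (conj (w j) * w i).im

/-- The sequence of sums over the interiors of the windows of length `r`. -/
def windowSum (r : ℕ) (w : ℕ → ℂ) (j : ℕ) : ℂ := ∑ i ∈ Finset.Ico (j + 1) (j + r), w i

open ComplexConjugate in
theorem im_conj_sum_mul_sum_nonneg {w : ℕ → ℂ} {s t : Finset ℕ}
    (h : ∀ a ∈ s, ∀ b ∈ t, 0 ≤ (conj (w a) * w b).im) :
    0 ≤ (conj (∑ a ∈ s, w a) * ∑ b ∈ t, w b).im := by
  rw [map_sum, Finset.sum_mul_sum, Complex.im_sum]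
  refine Finset.sum_nonneg fun a ha => ?_
  rw [Complex.im_sum]
  exact Finset.sum_nonneg fun b hb => h a ha b hb

open ComplexConjugate in
theorem im_conj_mul_mul_self (y z : ℂ) : (conj z * (y * z)).im = y.im * Complex.normSq z := by
  simp [Complex.normSq_apply]; ring

open ComplexConjugate in
theorem im_conj_mul_self (z : ℂ) : (conj z * z).im = 0 := by
  simp; ring

theorem sum_Ico_add_period {r : ℕ} {y : ℂ} {w : ℕ → ℂ} (hw : ∀ j, w (j + r) = y * w j)
    (a b : ℕ) : ∑ i ∈ Finset.Ico (a + r) (b + r), w i = y * ∑ i ∈ Finset.Ico a b, w i := by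
  rw [Finset.mul_sum, ← Finset.sum_Ico_add' w a b r]
  exact Finset.sum_congr rfl fun i _ => hw i

-- For `0 < d < r` the windows at `j` and `j + d` overlap: their sums are `S + w (j + d) + B` and `B
-- + w (j + r) + y * S`, with `B` the common part. The cross products of distinct pieces are
-- nonnegative termwise, except that of `S` with `y * S`: there indices may differ by more than `r`,
-- but the total is `y.im * |S|²`.
open ComplexConjugate in
theorem RotatingSequence.windowSum {r : ℕ} {y : ℂ} {w : ℕ → ℂ} (hy : 0 ≤ y.im)
    (hw : RotatingSequence r y w) : RotatingSequence r y (windowSum r w) := by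
  have hper : ∀ j, _root_.windowSum r w (j + r) = y * _root_.windowSum r w j := by
    intro j
    unfold _root_.windowSum
    rw [← sum_Ico_add_period hw.quasiperiodic, show j + r + 1 = j + 1 + r by ring]
  refine ⟨hper, fun j i hji hir => ?_⟩
  obtain ⟨d, rfl⟩ := Nat.exists_eq_add_of_le hji
  rcases Nat.eq_zero_or_pos d with rfl | hd
  · exact (im_conj_mul_self _).ge
  rcases eq_or_lt_of_le (show d ≤ r by omega) with rfl | hdr
  · rw [hper, im_conj_mul_mul_self]
    exact mul_nonneg hy (Complex.normSq_nonneg _)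
  have h1 : _root_.windowSum r w j = (∑ i ∈ Finset.Ico (j + 1) (j + d), w i) + w (j + d)
      + ∑ i ∈ Finset.Ico (j + d + 1) (j + r), w i := by
    unfold _root_.windowSum
    rw [← Finset.sum_Ico_succ_top (by omega), Finset.sum_Ico_consecutive _ (by omega) (by omega)]
  have h2 : _root_.windowSum r w (j + d) = (∑ i ∈ Finset.Ico (j + d + 1) (j + r), w i)
      + (w (j + r) + ∑ i ∈ Finset.Ico (j + 1 + r) (j + d + r), w i) := by
    unfold _root_.windowSum
    rw [show j + 1 + r = j + r + 1 by ring, ← Finset.sum_eq_sum_Ico_succ_bot (by omega),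
      Finset.sum_Ico_consecutive _ (by omega) (by omega)]
  have hSy := sum_Ico_add_period hw.quasiperiodic (j + 1) (j + d)
  have single : ∀ a, w a = ∑ i ∈ ({a} : Finset ℕ), w i := fun a => by simp
  have cross : ∀ s t : Finset ℕ, (∀ a ∈ s, ∀ b ∈ t, a ≤ b ∧ b ≤ a + r) →
      0 ≤ (conj (∑ a ∈ s, w a) * ∑ b ∈ t, w b).im := fun s t h =>
    im_conj_sum_mul_sum_nonneg fun a ha b hb =>
      hw.cross_nonneg a b (h a ha b hb).1 (h a ha b hb).2
  have hAB := cross (Finset.Ico (j + 1) (j + d + 1)) (Finset.Ico (j + d + 1) (j + r))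
    (by simp only [Finset.mem_Ico]; omega)
  rw [Finset.sum_Ico_succ_top (by omega)] at hAB
  have hBC := cross (Finset.Ico (j + d + 1) (j + r)) (Finset.Ico (j + r) (j + d + r))
    (by simp only [Finset.mem_Ico]; omega)
  rw [Finset.sum_eq_sum_Ico_succ_bot (show j + r < j + d + r by omega),
    show j + r + 1 = j + 1 + r by ring] at hBC
  have hSS : 0 ≤ (conj (∑ i ∈ Finset.Ico (j + 1) (j + d), w i) *
      ∑ i ∈ Finset.Ico (j + 1 + r) (j + d + r), w i).im := by
    rw [hSy, im_conj_mul_mul_self]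
    exact mul_nonneg hy (Complex.normSq_nonneg _)
  have hSr := cross (Finset.Ico (j + 1) (j + d)) {j + r}
    (by simp only [Finset.mem_Ico, Finset.mem_singleton]; omega)
  have hdS := cross {j + d} (Finset.Ico (j + 1 + r) (j + d + r))
    (by simp only [Finset.mem_Ico, Finset.mem_singleton]; omega)
  have hdr' := hw.cross_nonneg (j + d) (j + r) (by omega) (by omega)
  rw [← single] at hSr hdS
  rw [h1, h2]
  have hBB := im_conj_mul_self (∑ i ∈ Finset.Ico (j + d + 1) (j + r), w i)
  simp only [map_add, add_mul, mul_add, Complex.add_im] at *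
  linarith

-- If the terms before `i` vanish, the products `conj (w i) * w k` have nonnegative imaginary parts
-- summing to zero, so all are real. Comparing `w k` with `w (i + r) = y * w i`, where `y.im > 0`,
-- makes them nonnegative. As they sum to zero, the one with `k = i`, namely `|w i|²`, is zero.
open ComplexConjugate in
theorem RotatingSequence.eq_zero_of_windowSum_eq_zero {r : ℕ} {y : ℂ} {w : ℕ → ℂ} (hy : 0 < y.im)
    (hw : RotatingSequence r y w) {j : ℕ} (h0 : _root_.windowSum r w j = 0) :
    ∀ i, j < i → i < j + r → w i = 0 := by
  intro i
  induction i using Nat.strong_induction_on with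
  | _ i ih =>
  intro hji hir
  have hmul : ∑ k ∈ Finset.Ico (j + 1) (j + r), conj (w i) * w k = 0 := by
    rw [← Finset.mul_sum]
    unfold _root_.windowSum at h0
    rw [h0, mul_zero]
  have him : ∀ k ∈ Finset.Ico (j + 1) (j + r), 0 ≤ (conj (w i) * w k).im := by
    intro k hk
    rw [Finset.mem_Ico] at hk
    rcases lt_or_ge k i with hki | hki
    · simp [ih k hki (by omega) (by omega)]
    · exact hw.cross_nonneg i k hki (by omega)
  have him0 := (Finset.sum_eq_zero_iff_of_nonneg him).1
    (by rw [← Complex.im_sum, hmul, Complex.zero_im])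
  have hre : ∀ k ∈ Finset.Ico (j + 1) (j + r), 0 ≤ (conj (w i) * w k).re := by
    intro k hk
    have hz := him0 k hk
    rw [Finset.mem_Ico] at hk
    rcases lt_or_ge k i with hki | hki
    · simp [ih k hki (by omega) (by omega)]
    · have := hw.cross_nonneg k (i + r) (by omega) (by omega)
      rw [hw.quasiperiodic] at this
      have e : (conj (w k) * (y * w i)).im = y.im * (conj (w i) * w k).re
          - y.re * (conj (w i) * w k).im := by
        simp; ring
      rw [e, hz, mul_zero, sub_zero] at this
      exact nonneg_of_mul_nonneg_right this hy
  have hre0 := (Finset.sum_eq_zero_iff_of_nonneg hre).1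
    (by rw [← Complex.re_sum, hmul, Complex.zero_re]) i (Finset.mem_Ico.2 ⟨hji, hir⟩)
  have e : (conj (w i) * w i).re = Complex.normSq (w i) := by
    simp [Complex.normSq_apply]
  rwa [e, Complex.normSq_eq_zero] at hre0

/-- The sequence with value `yᵏ` at `rk` and `0` off the multiples of `r`. -/
def dilatedPowers (r : ℕ) (y : ℂ) (j : ℕ) : ℂ := if r ∣ j then y ^ (j / r) else 0

open ComplexConjugate in
theorem rotatingSequence_dilatedPowers {r : ℕ} (hr : 0 < r) {y : ℂ} (hy : 0 ≤ y.im) :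
    RotatingSequence r y (dilatedPowers r y) := by
  have hper : ∀ j, dilatedPowers r y (j + r) = y * dilatedPowers r y j := by
    intro j
    simp only [dilatedPowers, Nat.dvd_add_self_right, Nat.add_div_right _ hr]
    split_ifs <;> simp [pow_succ, mul_comm]
  refine ⟨hper, fun j i hji hir => ?_⟩
  by_cases hj : r ∣ j
  · by_cases hi : r ∣ i
    · obtain ⟨a, rfl⟩ := hj
      obtain ⟨b, rfl⟩ := hi
      have h1 := Nat.le_of_mul_le_mul_left hji hr
      have h2 : b ≤ a + 1 := Nat.le_of_mul_le_mul_left (by rw [mul_add, mul_one]; exact hir) hr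
      rcases (show b = a ∨ b = a + 1 by omega) with rfl | rfl
      · exact (im_conj_mul_self _).ge
      · rw [mul_add, mul_one, hper, im_conj_mul_mul_self]
        exact mul_nonneg hy (Complex.normSq_nonneg _)
    · simp [dilatedPowers, hi]
  · simp [dilatedPowers, hj]

/-- A zero of one iterate forces a zero of the preceding one at the next index, so two window sums
suffice. The first can vanish only at multiples of `r`, since any other window has a multiple of `r`
in its interior. A zero of the second would make `j + 1` and `j + 2` both such multiples; both are
interior because `r ≥ 3`. -/
theorem iterate_windowSum_ne_zero {r : ℕ} (hr : 3 ≤ r) {y : ℂ} (hy : 0 < y.im) (n j : ℕ) :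
    (windowSum r)^[n + 2] (dilatedPowers r y) j ≠ 0 := by
  have hy0 : y ≠ 0 := by rintro rfl; simp at hy
  have hrot : ∀ n, RotatingSequence r y ((windowSum r)^[n] (dilatedPowers r y)) := by
    intro n
    induction n with
    | zero => exact rotatingSequence_dilatedPowers (by omega) hy.le
    | succ n ih =>
      rw [Function.iterate_succ_apply']
      exact ih.windowSum hy.le
  induction n generalizing j with
  | zero =>
    have h1 : ∀ j, windowSum r (dilatedPowers r y) j = 0 → r ∣ j := by
      intro j h
      by_contra hj
      have hlt := Nat.mod_lt j (show 0 < r by omega)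
      have hpos : 0 < j % r := Nat.pos_of_ne_zero fun h => hj (Nat.dvd_of_mod_eq_zero h)
      have hdm := Nat.div_add_mod j r
      have := (hrot 0).eq_zero_of_windowSum_eq_zero hy h (r * (j / r + 1))
        (by rw [mul_add]; omega) (by rw [mul_add]; omega)
      simp [dilatedPowers, hy0] at this
    intro h
    rw [zero_add, Function.iterate_succ_apply'] at h
    have h2 := (hrot 1).eq_zero_of_windowSum_eq_zero hy h
    have h3 := h1 _ (h2 (j + 1) (by omega) (by omega))
    have h4 := h1 _ (h2 (j + 2) (by omega) (by omega))
    have := (Nat.dvd_sub h4 h3)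
    rw [show j + 2 - (j + 1) = 1 by omega, Nat.dvd_one] at this
    omega
  | succ n ih =>
    intro h
    rw [show n + 1 + 2 = (n + 2) + 1 by ring, Function.iterate_succ_apply'] at h
    exact ih (j + 1) ((hrot _).eq_zero_of_windowSum_eq_zero hy h (j + 1) (by omega) (by omega))

/-- Iterated window sums as sums over tuples. -/
theorem iterate_windowSum_eq_sum {V : Type*} [Fintype V] [DecidableEq V] (r : ℕ) (w : ℕ → ℂ)
    (j : ℕ) : (windowSum r)^[Fintype.card V] w j =
      ∑ s ∈ Fintype.piFinset (fun _ : V => Finset.Ico 1 r), w (j + ∑ v, s v) := by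
  -- The window sum is the polynomial `X + ⋯ + X^(r-1)` in the shift `D`, so its iterates expand
  -- like powers of that polynomial.
  let D : (ℕ → ℂ) →ₗ[ℂ] (ℕ → ℂ) := LinearMap.funLeft ℂ ℂ (· + 1)
  have hD : ∀ k w j, (D ^ k) w j = w (j + k) := by
    intro k
    induction k with
    | zero => intro w j; rfl
    | succ k ih =>
      intro w j
      rw [pow_succ', Module.End.mul_apply, LinearMap.funLeft_apply, ih]
      congr 1; ring
  let p : ℂ[X] := ∑ s ∈ Finset.Ico 1 r, X ^ s
  have hT : windowSum r = aeval D p := by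
    ext w j
    simp only [p, map_sum, map_pow, aeval_X, LinearMap.sum_apply, Finset.sum_apply, hD, windowSum]
    rw [Finset.sum_Ico_add (f := w), add_comm 1 j, add_comm r j]
  rw [hT, ← Module.End.coe_pow, ← map_pow, ← Finset.card_univ, ← Finset.prod_const,
    Finset.prod_univ_sum, map_sum, LinearMap.sum_apply, Finset.sum_apply]
  refine Finset.sum_congr rfl fun s _ => ?_
  rw [Finset.prod_pow_eq_pow_sum, map_pow, aeval_X, hD]

/-! ### Unique decomposition of lattice points of the dilated simplex -/

/-- A telescoping sum along the order of `V`; monotonicity of `g` keeps the natural subtraction from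
truncating. -/
theorem sum_sub_partial_sums {V : Type*} [LinearOrder V] (g : ℕ → ℕ) (hg : Monotone g)
    (hg0 : g 0 = 0) (z : V → ℕ)
    (s : Finset V) : ∑ w ∈ s, (g (∑ x ∈ s.filter (· ≤ w), z x) - g (∑ x ∈ s.filter (· < w), z x)) =
      g (∑ x ∈ s, z x) := by
  refine Finset.induction_on_max s (by simp [hg0]) ?_
  · intro a s ha ih
    have has : a ∉ s := fun h => lt_irrefl _ (ha a h)
    rw [Finset.sum_insert has]
    have h1 : (insert a s).filter (· ≤ a) = insert a s :=
      Finset.filter_true_of_mem fun x hx => by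
        rcases Finset.mem_insert.1 hx with rfl | hx
        exacts [le_rfl, (ha x hx).le]
    have h2 : (insert a s).filter (· < a) = s := by
      rw [Finset.filter_insert, if_neg (lt_irrefl a), Finset.filter_true_of_mem ha]
    have h3 : ∀ w ∈ s, (g (∑ x ∈ (insert a s).filter (· ≤ w), z x)
        - g (∑ x ∈ (insert a s).filter (· < w), z x)) =
        (g (∑ x ∈ s.filter (· ≤ w), z x) - g (∑ x ∈ s.filter (· < w), z x)) := fun w hw => by
      rw [Finset.filter_insert, if_neg (ha w hw).not_ge, Finset.filter_insert,
        if_neg (ha w hw).not_gt]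
    rw [h1, h2, Finset.sum_congr rfl h3, ih]
    exact Nat.sub_add_cancel (hg (by rw [Finset.sum_insert has]; omega))

section UnitStepCliques

variable {V : Type*} [Fintype V] [LinearOrder V]

/-- The lattice points of `E` are pairwise comparable, with partial sums differing by at most `1`. -/
def UnitStepClique (E : Finset (V → ℕ)) : Prop :=
  ∀ u ∈ E, ∀ u' ∈ E, UnitStep u u' ∨ UnitStep u' u

instance : DecidablePred (UnitStepClique (V := V)) := fun _ => Classical.propDecidable _

theorem UnitStepClique.subset {E E' : Finset (V → ℕ)} (h : UnitStepClique E') (hE : E ⊆ E') :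
    UnitStepClique E := fun u hu u' hu' => h u (hE hu) u' (hE hu')

theorem partialSums_eq_sum_lt_add (u : V → ℕ) (v : V) :
    partialSums u v = ∑ w ∈ Finset.univ.filter (· < v), u w + u v := by
  unfold partialSums
  have : Finset.univ.filter (· ≤ v) = insert v (Finset.univ.filter (· < v)) := by
    ext w; simp [le_iff_eq_or_lt]
  rw [this, Finset.sum_insert (by simp), add_comm]

theorem partialSums_injective : Function.Injective (partialSums (V := V)) := by
  intro u u' h
  ext v
  induction v using WellFoundedLT.induction with
  | _ v ih =>
  have hv := congrFun h v
  rw [partialSums_eq_sum_lt_add, partialSums_eq_sum_lt_add,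
    Finset.sum_congr rfl fun w hw => ih w (Finset.mem_filter.1 hw).2] at hv
  exact Nat.add_left_cancel hv

theorem partialSums_linearCombination (l : (V → ℕ) →₀ ℕ) (v : V) :
    partialSums (Finsupp.linearCombination ℕ id l) v =
      ∑ u ∈ l.support, l u * partialSums u v := by
  simp only [partialSums, Finsupp.linearCombination_apply, Finsupp.sum, Finset.sum_apply, id,
    Pi.smul_apply, smul_eq_mul, Finset.mul_sum]
  exact Finset.sum_comm

/-- The least element of the support of a weighted clique can be read off the weighted sum. -/
theorem exists_mem_support_partialSums_eq_div {l : (V → ℕ) →₀ ℕ} (hl : l ≠ 0)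
    (hc : UnitStepClique l.support) : ∃ u ∈ l.support, ∀ v,
      partialSums u v = partialSums (Finsupp.linearCombination ℕ id l) v / l.degree := by
  obtain ⟨u, hu, hmin⟩ := Finset.exists_min_image l.support (fun u => ∑ v, partialSums u v)
    (Finsupp.support_nonempty_iff.2 hl)
  have hstep : ∀ u' ∈ l.support, UnitStep u u' := by
    intro u' hu'
    refine (hc u hu u' hu').elim id fun h => ?_
    have hle : ∀ v ∈ Finset.univ, partialSums u' v ≤ partialSums u v := fun v _ => by
      rcases h v with h | h <;> omega
    have heq := (Finset.sum_eq_sum_iff_of_le hle).1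
      (le_antisymm (Finset.sum_le_sum hle) (hmin u' hu'))
    exact fun v => Or.inl (heq v (Finset.mem_univ v))
  refine ⟨u, hu, fun v => ?_⟩
  rw [partialSums_linearCombination, Finsupp.degree_apply]
  symm
  -- At `v` the weighted mean of partial sums lies in `[a, a + 1)` for `a = partialSums u v`: every
  -- member contributes `a` or `a + 1`, and `u` contributes `a` with positive weight.
  refine Nat.div_eq_of_lt_le ?_ ?_
  · rw [Finset.mul_sum]
    refine Finset.sum_le_sum fun u' hu' => ?_
    rw [mul_comm]
    exact Nat.mul_le_mul_left _ (by rcases hstep u' hu' v with h | h <;> omega)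
  · rw [Finset.mul_sum]
    refine Finset.sum_lt_sum (fun u' hu' => ?_) ⟨u, hu, ?_⟩
    · rw [mul_comm]
      exact Nat.mul_le_mul_right _ (by rcases hstep u' hu' v with h | h <;> omega)
    · rw [mul_comm]
      exact Nat.mul_lt_mul_of_pos_right (Nat.lt_succ_self _)
        (Nat.pos_of_ne_zero (Finsupp.mem_support_iff.1 hu))

/-- The degree and the weighted sum determine the least vertex, so one copy of it can be removed
from both sides; induct on the degree. -/
theorem linearCombination_injOn_unitStepClique {l l' : (V → ℕ) →₀ ℕ}
    (hc : UnitStepClique l.support) (hc' : UnitStepClique l'.support)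
    (hdeg : l.degree = l'.degree)
    (h : Finsupp.linearCombination ℕ id l = Finsupp.linearCombination ℕ id l') : l = l' := by
  induction hm : l.degree generalizing l l' with
  | zero =>
    rw [hm, eq_comm] at hdeg
    rw [Finsupp.degree_eq_zero_iff] at hm hdeg
    rw [hm, hdeg]
  | succ m ih =>
    have hl : l ≠ 0 := by rintro rfl; simp at hm
    have hl' : l' ≠ 0 := by rintro rfl; rw [hm] at hdeg; simp at hdeg
    obtain ⟨u, hu, hup⟩ := exists_mem_support_partialSums_eq_div hl hc
    obtain ⟨u', hu', hup'⟩ := exists_mem_support_partialSums_eq_div hl' hc'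
    obtain rfl : u = u' := partialSums_injective (funext fun v => by rw [hup, hup', h, hdeg])
    have split : ∀ k : (V → ℕ) →₀ ℕ, u ∈ k.support →
        ∃ k', k = Finsupp.single u 1 + k' ∧ k'.support ⊆ k.support := by
      intro k hk
      have hle : Finsupp.single u 1 ≤ k := by
        rw [Finsupp.single_le_iff]
        exact Nat.one_le_iff_ne_zero.2 (Finsupp.mem_support_iff.1 hk)
      exact ⟨k - Finsupp.single u 1, (add_tsub_cancel_of_le hle).symm,
        Finsupp.support_mono tsub_le_self⟩
    obtain ⟨k, hk, hks⟩ := split l hu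
    obtain ⟨k', hk', hks'⟩ := split l' hu'
    rw [hk, hk', map_add, map_add] at h hdeg
    rw [hk, map_add, Finsupp.degree_single] at hm
    rw [hk, hk', ih (hc.subset hks) (hc'.subset hks') (by simpa using hdeg) (by simpa using h)
      (by omega)]

/-- Hermite's identity: raising `a` by one trades the term `a / m` for `(a + m) / m = a / m + 1`. -/
theorem sum_range_add_div {m : ℕ} (hm : 0 < m) (a : ℕ) : ∑ i ∈ Finset.range m, (a + i) / m = a := by
  induction a with
  | zero =>
    refine Finset.sum_eq_zero fun i hi => ?_
    rw [zero_add, Nat.div_eq_of_lt (Finset.mem_range.1 hi)]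
  | succ a ih =>
    have h := (Finset.sum_range_succ' (fun i => (a + i) / m) m).symm.trans
      (Finset.sum_range_succ (fun i => (a + i) / m) m)
    rw [ih, Nat.add_div_right _ hm, add_zero] at h
    rw [Finset.sum_congr rfl fun i _ => by rw [show a + 1 + i = a + (i + 1) by ring]]
    omega

/-- The lattice point with partial sums `⌊(aᵥ + i) / m⌋`, where `a` are those of `z`. -/
def floorPoint (m i : ℕ) (z : V → ℕ) (v : V) : ℕ :=
  (partialSums z v + i) / m - (∑ w ∈ Finset.univ.filter (· < v), z w + i) / m

theorem partialSums_floorPoint {m i : ℕ} (hi : i < m) (z : V → ℕ) (v : V) :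
    partialSums (floorPoint m i z) v = (partialSums z v + i) / m := by
  have := sum_sub_partial_sums (fun a => (a + i) / m)
    (fun a b h => Nat.div_le_div_right (by omega)) (by simp [Nat.div_eq_of_lt hi]) z
    (Finset.univ.filter (· ≤ v))
  refine Eq.trans (Finset.sum_congr rfl fun w hw => ?_) this
  have hwv := (Finset.mem_filter.1 hw).2
  rw [Finset.filter_filter, Finset.filter_filter]
  unfold floorPoint partialSums
  congr 4
  · ext x; simp only [Finset.mem_filter]; grind
  · ext x; simp only [Finset.mem_filter]; grind

theorem sum_floorPoint {m i : ℕ} (hi : i < m) (z : V → ℕ) :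
    ∑ v, floorPoint m i z v = (∑ v, z v + i) / m :=
  sum_sub_partial_sums (fun a => (a + i) / m)
    (fun a b h => Nat.div_le_div_right (by omega)) (by simp [Nat.div_eq_of_lt hi]) z Finset.univ

theorem floorPoint_eq_zero {m i : ℕ} {z : V → ℕ} {v : V} (hv : z v = 0) :
    floorPoint m i z v = 0 := by
  rw [floorPoint, partialSums_eq_sum_lt_add, hv, add_zero, Nat.sub_self]

theorem sum_range_floorPoint {m : ℕ} (hm : 0 < m) (z : V → ℕ) :
    ∑ i ∈ Finset.range m, floorPoint m i z = z := by
  apply partialSums_injective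
  ext v
  have : partialSums (∑ i ∈ Finset.range m, floorPoint m i z) v =
      ∑ i ∈ Finset.range m, partialSums (floorPoint m i z) v := by
    simp only [partialSums, Finset.sum_apply]
    exact Finset.sum_comm
  rw [this, Finset.sum_congr rfl fun i hi => partialSums_floorPoint (Finset.mem_range.1 hi) z v,
    sum_range_add_div hm]

theorem unitStep_floorPoint {m i j : ℕ} (hij : i ≤ j) (hj : j < m) (z : V → ℕ) :
    UnitStep (floorPoint m i z) (floorPoint m j z) := by
  intro v
  rw [partialSums_floorPoint (hij.trans_lt hj), partialSums_floorPoint hj]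
  have h1 : (partialSums z v + i) / m ≤ (partialSums z v + j) / m :=
    Nat.div_le_div_right (by omega)
  have h2 : (partialSums z v + j) / m ≤ (partialSums z v + i + m) / m :=
    Nat.div_le_div_right (by omega)
  rw [Nat.add_div_right _ (by omega)] at h2
  omega

/-- Multisets of `m` lattice points, supported on a face of the edgewise subdivision over `F`. -/
@[irreducible]
def weightedFaces (r : ℕ) (F : Finset V) (m : ℕ) : Finset ((V → ℕ) →₀ ℕ) :=
  (Finset.finsuppAntidiag (Finset.piAntidiag F r) m).filter fun l => UnitStepClique l.support

theorem mem_weightedFaces {r : ℕ} {F : Finset V} {m : ℕ} {l : (V → ℕ) →₀ ℕ} :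
    l ∈ weightedFaces r F m ↔
      l ∈ Finset.finsuppAntidiag (Finset.piAntidiag F r) m ∧ UnitStepClique l.support := by
  rw [weightedFaces, Finset.mem_filter]

theorem mem_finsuppAntidiag_iff_degree {ι : Type*} [DecidableEq ι] {s : Finset ι} {m : ℕ}
    {l : ι →₀ ℕ} : l ∈ Finset.finsuppAntidiag s m ↔ l.degree = m ∧ l.support ⊆ s := by
  rw [Finset.mem_finsuppAntidiag, Finsupp.degree_apply]
  refine and_congr_left fun h => ?_
  rw [Finset.sum_subset h fun i _ hi => Finsupp.notMem_support_iff.1 hi]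

theorem sum_univ_of_mem_piAntidiag {F : Finset V} {r : ℕ} {u : V → ℕ}
    (h : u ∈ Finset.piAntidiag F r) : ∑ v, u v = r := by
  rw [Finset.mem_piAntidiag] at h
  rw [← h.1]
  exact (Finset.sum_subset (Finset.subset_univ F) fun v _ hv => by_contra fun h0 => hv (h.2 v h0)).symm

theorem mem_piAntidiag_of_sum_univ {F : Finset V} {r : ℕ} {u : V → ℕ}
    (h : ∑ v, u v = r) (hF : ∀ v, u v ≠ 0 → v ∈ F) : u ∈ Finset.piAntidiag F r := by
  rw [Finset.mem_piAntidiag]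
  refine ⟨?_, hF⟩
  rw [← h]
  exact Finset.sum_subset (Finset.subset_univ F) fun v _ hv => by_contra fun h0 => hv (hF v h0)

/-- The edgewise subdivision triangulates the dilated simplex: a lattice point of the `mr`-fold
dilation is the sum of a unique multiset of `m` vertices spanning a face. -/
theorem card_weightedFaces (r : ℕ) (F : Finset V) (m : ℕ) :
    (weightedFaces r F m).card = (Finset.piAntidiag F (m * r)).card := by
  refine Finset.card_bij (fun l _ => Finsupp.linearCombination ℕ id l) ?_ ?_ ?_
  · intro l hl
    have hmem := (mem_weightedFaces.1 hl).1
    have hdeg := (mem_finsuppAntidiag_iff_degree.1 hmem).1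
    have hsupp := (mem_finsuppAntidiag_iff_degree.1 hmem).2
    refine mem_piAntidiag_of_sum_univ ?_ ?_
    · simp only [Finsupp.linearCombination_apply, Finsupp.sum, Finset.sum_apply, id,
        Pi.smul_apply, smul_eq_mul]
      rw [Finset.sum_comm, ← hdeg, Finsupp.degree_apply, Finset.sum_mul]
      refine Finset.sum_congr rfl fun u hu => ?_
      rw [← Finset.mul_sum, sum_univ_of_mem_piAntidiag (hsupp hu)]
    · intro v hv
      simp only [Finsupp.linearCombination_apply, Finsupp.sum, Finset.sum_apply, id,
        Pi.smul_apply, smul_eq_mul] at hv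
      obtain ⟨u, hu, hne⟩ := Finset.exists_ne_zero_of_sum_ne_zero hv
      exact (Finset.mem_piAntidiag.1 (hsupp hu)).2 v (right_ne_zero_of_mul hne)
  · intro l hl l' hl' h
    refine linearCombination_injOn_unitStepClique (mem_weightedFaces.1 hl).2
      (mem_weightedFaces.1 hl').2 ?_ h
    rw [(mem_finsuppAntidiag_iff_degree.1 (mem_weightedFaces.1 hl).1).1,
      (mem_finsuppAntidiag_iff_degree.1 (mem_weightedFaces.1 hl').1).1]
  · intro z hz
    rcases Nat.eq_zero_or_pos m with rfl | hm
    · refine ⟨0, mem_weightedFaces.2 ⟨by rw [Finset.finsuppAntidiag_zero, Finset.mem_singleton],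
        fun u hu => by simp at hu⟩, ?_⟩
      have h0 := sum_univ_of_mem_piAntidiag hz
      rw [zero_mul, Finset.sum_eq_zero_iff] at h0
      rw [map_zero]
      exact funext fun v => (h0 v (Finset.mem_univ v)).symm
    -- The `m` floor points sum to `z` by Hermite's identity applied to partial sums, and they form
    -- a clique since the floors for two offsets below `m` differ by at most one.
    · let l : (V → ℕ) →₀ ℕ := ∑ i ∈ Finset.range m, Finsupp.single (floorPoint m i z) 1
      have hsupp : ∀ u ∈ l.support, ∃ i < m, u = floorPoint m i z := by
        intro u hu
        obtain ⟨i, hi, hu⟩ := Finset.mem_biUnion.1 (Finsupp.support_finsetSum hu)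
        exact ⟨i, Finset.mem_range.1 hi, Finset.mem_singleton.1 (Finsupp.support_single_subset hu)⟩
      have hsub : l.support ⊆ Finset.piAntidiag F r := by
        intro u hu
        obtain ⟨i, hi, rfl⟩ := hsupp u hu
        refine mem_piAntidiag_of_sum_univ ?_ fun v hv =>
          (Finset.mem_piAntidiag.1 hz).2 v fun h0 => hv (floorPoint_eq_zero h0)
        rw [sum_floorPoint hi, sum_univ_of_mem_piAntidiag hz, Nat.mul_add_div hm,
          Nat.div_eq_of_lt hi, add_zero]
      have hl : l ∈ weightedFaces r F m := by
        refine mem_weightedFaces.2 ⟨mem_finsuppAntidiag_iff_degree.2 ⟨by simp [l], hsub⟩, ?_⟩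
        intro u hu u' hu'
        obtain ⟨i, hi, rfl⟩ := hsupp u hu
        obtain ⟨j, hj, rfl⟩ := hsupp u' hu'
        exact (le_total i j).imp (fun h => unitStep_floorPoint h hj z)
          fun h => unitStep_floorPoint h hi z
      refine ⟨l, hl, ?_⟩
      simp only [l, map_sum, Finsupp.linearCombination_single, one_smul, id]
      exact sum_range_floorPoint hm z

end UnitStepCliques

/-! ### Generating functions and the `h`-polynomial over each `F` -/

section GeneratingFunctions

variable {V : Type*} [Fintype V] [LinearOrder V]

/-- The faces, with the empty one, of the edgewise subdivision over `F`. -/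
@[irreducible]
def edgewiseFaces (r : ℕ) (F : Finset V) : Finset (Finset (V → ℕ)) :=
  (Finset.piAntidiag F r).powerset.filter UnitStepClique

theorem mem_edgewiseFaces {r : ℕ} {F : Finset V} {E : Finset (V → ℕ)} :
    E ∈ edgewiseFaces r F ↔ E ⊆ Finset.piAntidiag F r ∧ UnitStepClique E := by
  rw [edgewiseFaces, Finset.mem_filter, Finset.mem_powerset]

/-- The series is `(x + x² + ⋯)^|E|`: each element of `E` receives a positive weight. -/
theorem coeff_X_mul_mk_one_pow_card {ι : Type*} [DecidableEq ι] (E : Finset ι) (m : ℕ) :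
    PowerSeries.coeff m ((PowerSeries.X * PowerSeries.mk 1 : PowerSeries ℝ) ^ E.card) =
      (((Finset.finsuppAntidiag E m).filter fun l => l.support = E).card : ℝ) := by
  have hc : ∀ n, PowerSeries.coeff n (PowerSeries.X * PowerSeries.mk 1 : PowerSeries ℝ) =
      if n = 0 then 0 else 1 := by
    rintro (_ | n)
    · rw [PowerSeries.coeff_zero_X_mul, if_pos rfl]
    · rw [PowerSeries.coeff_succ_X_mul, PowerSeries.coeff_mk, if_neg n.succ_ne_zero, Pi.one_apply]
  rw [← Finset.prod_const, PowerSeries.coeff_prod, Finset.card_filter, Nat.cast_sum]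
  refine Finset.sum_congr rfl fun l hl => ?_
  have hsub := (Finset.mem_finsuppAntidiag.1 hl).2
  simp only [hc]
  by_cases h : l.support = E
  · rw [if_pos h, Nat.cast_one]
    refine Finset.prod_eq_one fun i hi => if_neg ?_
    rwa [← h, Finsupp.mem_support_iff] at hi
  · rw [if_neg h, Nat.cast_zero]
    have : ∃ i ∈ E, i ∉ l.support := by
      by_contra! hE
      exact h (hsub.antisymm hE)
    obtain ⟨i, hi, hil⟩ := this
    exact Finset.prod_eq_zero hi (if_pos (Finsupp.notMem_support_iff.1 hil))

theorem coeff_sum_edgewiseFaces (r : ℕ) (F : Finset V) (m : ℕ) :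
    PowerSeries.coeff m (∑ E ∈ edgewiseFaces r F,
      (PowerSeries.X * PowerSeries.mk 1 : PowerSeries ℝ) ^ E.card) =
      ((Finset.piAntidiag F (m * r)).card : ℝ) := by
  rw [← card_weightedFaces, map_sum,
    Finset.card_eq_sum_card_fiberwise (f := Finsupp.support) (t := edgewiseFaces r F), Nat.cast_sum]
  · refine Finset.sum_congr rfl fun E hE => ?_
    rw [coeff_X_mul_mk_one_pow_card]
    congr 2
    ext l
    rw [mem_edgewiseFaces] at hE
    rw [Finset.mem_filter, Finset.mem_filter, mem_weightedFaces, mem_finsuppAntidiag_iff_degree,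
      mem_finsuppAntidiag_iff_degree]
    constructor
    · rintro ⟨⟨hd, -⟩, rfl⟩
      exact ⟨⟨⟨hd, hE.1⟩, hE.2⟩, rfl⟩
    · rintro ⟨⟨⟨hd, -⟩, -⟩, rfl⟩
      exact ⟨⟨hd, subset_rfl⟩, rfl⟩
  · intro l hl
    rw [Finset.mem_coe, mem_weightedFaces, mem_finsuppAntidiag_iff_degree] at hl
    rw [Finset.mem_coe, mem_edgewiseFaces]
    exact ⟨hl.1.2, hl.2⟩

/-- The vectors supported on `F`, with entries in `{0, …, r - 1}` and sum divisible by `r`. -/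
@[irreducible]
def residueVectors (r : ℕ) (F : Finset V) : Finset (V → ℕ) :=
  (Fintype.piFinset fun _ => Finset.range r).filter
    fun s => r ∣ ∑ v, s v ∧ ∀ v, s v ≠ 0 → v ∈ F

theorem mem_residueVectors {r : ℕ} {F : Finset V} {s : V → ℕ} :
    s ∈ residueVectors r F ↔ (∀ v, s v < r) ∧ r ∣ ∑ v, s v ∧ ∀ v, s v ≠ 0 → v ∈ F := by
  rw [residueVectors, Finset.mem_filter, Fintype.mem_piFinset]
  simp only [Finset.mem_range]

/-- The section `∑ₖ c_{rk} Xᵏ` of the polynomial `(1 + X + ⋯ + X^(r-1))^|F| = ∑ c_j X^j`. -/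
def residuePolynomial (r : ℕ) (F : Finset V) : ℝ[X] :=
  ∑ s ∈ residueVectors r F, X ^ ((∑ v, s v) / r)

theorem coeff_mk_one_pow_card (F : Finset V) (m : ℕ) :
    PowerSeries.coeff m ((PowerSeries.mk 1 : PowerSeries ℝ) ^ F.card) =
      ((Finset.piAntidiag F m).card : ℝ) := by
  rw [← Finset.prod_const, PowerSeries.coeff_prod]
  simp only [PowerSeries.coeff_mk, Pi.one_apply, Finset.prod_const_one, Finset.sum_const,
    nsmul_eq_mul, mul_one]
  congr 1
  refine Finset.card_bij (fun l _ => l) ?_ (fun _ _ _ _ h => DFunLike.coe_injective h) ?_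
  · intro l hl
    rw [Finset.mem_finsuppAntidiag] at hl
    exact Finset.mem_piAntidiag.2 ⟨hl.1, fun i hi => hl.2 (Finsupp.mem_support_iff.2 hi)⟩
  · intro u hu
    rw [Finset.mem_piAntidiag] at hu
    refine ⟨Finsupp.equivFunOnFinite.symm u, Finset.mem_finsuppAntidiag.2 ⟨hu.1, ?_⟩, rfl⟩
    intro i hi
    exact hu.2 i (Finsupp.mem_support_iff.1 hi)

/-- Writing `z = s + r q` entrywise, the points with residue vector `s` correspond to the quotients
`q`, whose entries sum to `m - (∑ s) / r`. -/
theorem card_filter_mod_eq {r : ℕ} (hr : 0 < r) {F : Finset V} (m : ℕ) {s : V → ℕ}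
    (hs : s ∈ residueVectors r F) :
    ((Finset.piAntidiag F (m * r)).filter fun z => (fun v => z v % r) = s).card =
      if (∑ v, s v) / r ≤ m then (Finset.piAntidiag F (m - (∑ v, s v) / r)).card else 0 := by
  rw [mem_residueVectors] at hs
  obtain ⟨hlt, ⟨k, hk⟩, hsF⟩ := hs
  have hdecomp : ∀ z : V → ℕ, (fun v => z v % r) = s →
      ∑ v, z v = r * (k + ∑ v, z v / r) := by
    rintro z rfl
    rw [mul_add, ← hk, Finset.mul_sum, ← Finset.sum_add_distrib]
    exact Finset.sum_congr rfl fun v _ => (Nat.mod_add_div _ _).symm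
  rw [hk, Nat.mul_div_cancel_left k hr]
  split_ifs with hkm
  · refine Finset.card_nbij' (fun z v => z v / r) (fun q v => s v + r * q v) ?_ ?_ ?_ ?_
    · intro z hz
      obtain ⟨hz, hzs⟩ := Finset.mem_filter.1 hz
      refine mem_piAntidiag_of_sum_univ ?_ fun v hv =>
        (Finset.mem_piAntidiag.1 hz).2 v fun h0 => hv (by simp [h0])
      have h1 := hdecomp z hzs
      rw [sum_univ_of_mem_piAntidiag hz, mul_comm m r] at h1
      have := Nat.eq_of_mul_eq_mul_left hr h1
      simp only
      omega
    · intro q hq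
      rw [Finset.mem_coe] at hq
      refine Finset.mem_filter.2 ⟨mem_piAntidiag_of_sum_univ ?_ fun v hv => ?_, ?_⟩
      · rw [Finset.sum_add_distrib, ← Finset.mul_sum, sum_univ_of_mem_piAntidiag hq, hk, ← mul_add,
          Nat.add_sub_cancel' hkm, mul_comm]
      · by_cases h0 : s v = 0
        · simp only [h0, zero_add] at hv
          exact (Finset.mem_piAntidiag.1 hq).2 v (right_ne_zero_of_mul hv)
        · exact hsF v h0
      · ext v
        rw [Nat.add_mul_mod_self_left, Nat.mod_eq_of_lt (hlt v)]
    · intro z hz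
      obtain ⟨-, rfl⟩ := Finset.mem_filter.1 hz
      exact funext fun v => Nat.mod_add_div _ _
    · intro q _
      ext v
      simp only
      rw [Nat.add_mul_div_left _ _ hr, Nat.div_eq_of_lt (hlt v), zero_add]
  · rw [Finset.card_eq_zero, Finset.filter_eq_empty_iff]
    intro z hz hzs
    have h1 := hdecomp z hzs
    rw [sum_univ_of_mem_piAntidiag hz, mul_comm m r] at h1
    have := Nat.eq_of_mul_eq_mul_left hr h1
    omega

theorem coeff_residuePolynomial_mul {r : ℕ} (hr : 0 < r) (F : Finset V) (m : ℕ) :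
    PowerSeries.coeff m ((residuePolynomial r F : PowerSeries ℝ) * PowerSeries.mk 1 ^ F.card) =
      ((Finset.piAntidiag F (m * r)).card : ℝ) := by
  have hcoe : (residuePolynomial r F : PowerSeries ℝ) =
      ∑ s ∈ residueVectors r F, PowerSeries.X ^ ((∑ v, s v) / r) := by
    rw [residuePolynomial, ← Polynomial.coeToPowerSeries.ringHom_apply, map_sum]
    simp
  rw [Finset.card_eq_sum_card_fiberwise (f := fun (z : V → ℕ) v => z v % r) (t := residueVectors r F),
    hcoe, Finset.sum_mul, map_sum, Nat.cast_sum]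
  · refine Finset.sum_congr rfl fun s hs => ?_
    rw [card_filter_mod_eq hr m hs, PowerSeries.coeff_X_pow_mul', coeff_mk_one_pow_card]
    split_ifs <;> simp
  · intro z hz
    rw [Finset.mem_coe] at hz
    rw [Finset.mem_coe, mem_residueVectors]
    refine ⟨fun v => Nat.mod_lt _ hr, ?_, fun v hv =>
      (Finset.mem_piAntidiag.1 hz).2 v fun h0 => hv (by simp [h0])⟩
    rw [Nat.dvd_iff_mod_eq_zero, ← Finset.sum_nat_mod, sum_univ_of_mem_piAntidiag hz,
      Nat.mul_mod_left]

/-- The two counts of lattice points give equal power series; `(1 - X)^D` clears denominators. The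
exponent `D` is left free so that the identity can itself determine the dimension. -/
theorem sum_edgewiseFaces_mul_pow {r : ℕ} (hr : 0 < r) (F : Finset V) {D : ℕ} (hF : F.card ≤ D)
    (hD : ∀ E ∈ edgewiseFaces r F, E.card ≤ D) :
    ∑ E ∈ edgewiseFaces r F, X ^ E.card * (1 - X : ℝ[X]) ^ (D - E.card) =
      residuePolynomial r F * (1 - X) ^ (D - F.card) := by
  apply Polynomial.coe_injective ℝ
  have hinv : (PowerSeries.mk 1 : PowerSeries ℝ) * (1 - PowerSeries.X) = 1 :=
    PowerSeries.mk_one_mul_one_sub_eq_one ℝ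
  have h : ∑ E ∈ edgewiseFaces r F, (PowerSeries.X * PowerSeries.mk 1 : PowerSeries ℝ) ^ E.card =
      (residuePolynomial r F : PowerSeries ℝ) * PowerSeries.mk 1 ^ F.card := by
    ext m
    rw [coeff_sum_edgewiseFaces, coeff_residuePolynomial_mul hr]
  have hcancel : ∀ k ≤ D, (PowerSeries.mk 1 : PowerSeries ℝ) ^ k * (1 - PowerSeries.X) ^ D =
      (1 - PowerSeries.X) ^ (D - k) := by
    intro k hk
    rw [← Nat.add_sub_cancel' hk, pow_add, ← mul_assoc, ← mul_pow, hinv, one_pow, one_mul,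
      Nat.add_sub_cancel_left]
  have h2 := congrArg (· * (1 - PowerSeries.X) ^ D) h
  simp only [Finset.sum_mul, mul_assoc, hcancel _ hF, mul_pow] at h2
  rw [Finset.sum_congr rfl fun E hE => by rw [hcancel _ (hD E hE)]] at h2
  rw [← Polynomial.coeToPowerSeries.ringHom_apply, ← Polynomial.coeToPowerSeries.ringHom_apply,
    map_sum]
  simpa using h2

theorem eval_one_residuePolynomial_pos {r : ℕ} (hr : 0 < r) (F : Finset V) :
    0 < (residuePolynomial r F).eval 1 := by
  rw [residuePolynomial, eval_finsetSum]
  simp only [eval_pow, eval_X, one_pow, Finset.sum_const, nsmul_eq_mul, mul_one, Nat.cast_pos]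
  exact Finset.card_pos.2 ⟨0, mem_residueVectors.2 ⟨fun _ => hr, by simp, by simp⟩⟩

/-- Compare values at `1` with `D` the larger of the two numbers. Were they different, one side of
the identity would vanish there, while the other would be positive: it counts residue vectors or
faces of maximal size. -/
theorem sup_card_edgewiseFaces {r : ℕ} (hr : 0 < r) (F : Finset V) :
    (edgewiseFaces r F).sup Finset.card = F.card := by
  set d := (edgewiseFaces r F).sup Finset.card with hd
  have hle : ∀ E ∈ edgewiseFaces r F, E.card ≤ d := fun E hE => Finset.le_sup hE
  have hne : (edgewiseFaces r F).Nonempty :=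
    ⟨∅, mem_edgewiseFaces.2 ⟨Finset.empty_subset _, fun u hu => by simp at hu⟩⟩
  obtain ⟨E₀, hE₀, hcard⟩ := Finset.exists_mem_eq_sup _ hne Finset.card
  rcases lt_trichotomy d F.card with h | h | h
  · have := congrArg (eval 1) (sum_edgewiseFaces_mul_pow hr F le_rfl
      fun E hE => (hle E hE).trans h.le)
    rw [Nat.sub_self, pow_zero, mul_one, eval_finsetSum, Finset.sum_eq_zero] at this
    · exact absurd this (eval_one_residuePolynomial_pos hr F).ne
    · intro E hE
      have := hle E hE
      simp [show F.card - E.card ≠ 0 by omega]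
  · exact h
  · have := congrArg (eval 1) (sum_edgewiseFaces_mul_pow hr F h.le hle)
    rw [eval_mul, eval_pow, eval_sub, eval_one, eval_X, sub_self, zero_pow (by omega), mul_zero,
      eval_finsetSum, Finset.sum_eq_zero_iff_of_nonneg] at this
    · have := this E₀ hE₀
      simp [hd, hcard] at this
    · intro E _
      simp only [eval_mul, eval_pow, eval_sub, eval_one, eval_X, sub_self, one_pow, one_mul]
      positivity

theorem mem_insert_empty_carrierRestrict {r : ℕ} (hr : 0 < r) (F : Finset V)
    (E : Finset (V → ℕ)) :
    E ∈ insert ∅ (carrierRestrict (edgewiseSubdivision r (simplex V)) latticeCarrier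
      latticeCarrier_mono F).faces ↔ E ∈ edgewiseFaces r F := by
  have hcar : latticeCarrier E ⊆ F ↔ ∀ u ∈ E, ∀ v, u v ≠ 0 → v ∈ F := by
    rw [latticeCarrier, Finset.sup_le_iff]
    simp [Finset.subset_iff]
  rw [mem_edgewiseFaces]
  constructor
  · rintro (rfl | ⟨⟨-, hsum, -, hc⟩, hF⟩)
    · exact ⟨Finset.empty_subset _, fun u hu => by simp at hu⟩
    · exact ⟨fun u hu => mem_piAntidiag_of_sum_univ (hsum u hu) (hcar.1 hF u hu), hc⟩
  · rintro ⟨hsub, hc⟩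
    rcases E.eq_empty_or_nonempty with rfl | hne
    · exact Or.inl rfl
    · have hsum : ∀ u ∈ E, ∑ v, u v = r := fun u hu => sum_univ_of_mem_piAntidiag (hsub hu)
      refine Or.inr ⟨⟨hne, hsum, ?_, hc⟩,
        hcar.2 fun u hu => (Finset.mem_piAntidiag.1 (hsub hu)).2⟩
      obtain ⟨u, hu⟩ := hne
      obtain ⟨v, -, hv⟩ := Finset.exists_ne_zero_of_sum_ne_zero ((hsum u hu).trans_ne hr.ne')
      exact ⟨v, Finset.mem_sup.2 ⟨u, hu, Finset.mem_filter.2 ⟨Finset.mem_univ v, hv⟩⟩⟩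

theorem hPolynomial_carrierRestrict {r : ℕ} (hr : 0 < r) (F : Finset V) :
    hPolynomial (carrierRestrict (edgewiseSubdivision r (simplex V)) latticeCarrier
      latticeCarrier_mono F) = residuePolynomial r F := by
  have hfaces : insert ∅ (carrierRestrict (edgewiseSubdivision r (simplex V)) latticeCarrier
      latticeCarrier_mono F).faces = (edgewiseFaces r F : Set (Finset (V → ℕ))) :=
    Set.ext fun E => mem_insert_empty_carrierRestrict hr F E
  have htop : topSize (carrierRestrict (edgewiseSubdivision r (simplex V)) latticeCarrier
      latticeCarrier_mono F) = F.card := by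
    have hne : (edgewiseFaces r F).Nonempty :=
      ⟨∅, (mem_insert_empty_carrierRestrict hr F ∅).1 (Set.mem_insert _ _)⟩
    rw [topSize, hfaces, ← sup_card_edgewiseFaces hr F, ← Finset.sup'_eq_sup hne,
      Finset.sup'_eq_csSup_image]
  have hle : ∀ E ∈ edgewiseFaces r F, E.card ≤ F.card := fun E hE =>
    (Finset.le_sup (f := Finset.card) hE).trans_eq (sup_card_edgewiseFaces hr F)
  have hcount : ∀ k, faceCount (carrierRestrict (edgewiseSubdivision r (simplex V)) latticeCarrier
      latticeCarrier_mono F) k = ((edgewiseFaces r F).filter fun E => E.card = k).card := by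
    intro k
    rw [faceCount, hfaces, ← Set.ncard_coe_finset]
    congr 1
    ext E
    simp
  have h := sum_edgewiseFaces_mul_pow hr F le_rfl hle
  rw [Nat.sub_self, pow_zero, mul_one] at h
  rw [← h, hPolynomial, htop, ← Finset.sum_fiberwise_of_maps_to (g := Finset.card)
    (t := Finset.range (F.card + 1)) fun E hE => Finset.mem_range.2 (Nat.lt_succ_of_le (hle E hE))]
  refine Finset.sum_congr rfl fun k _ => ?_
  rw [hcount, Finset.sum_congr rfl fun E hE => by rw [(Finset.mem_filter.1 hE).2],
    Finset.sum_const, nsmul_eq_mul, mul_assoc]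

end GeneratingFunctions

/-! ### The local `h`-polynomial and its values -/

section LocalHPolynomial

variable {V : Type*} [Fintype V] [LinearOrder V]

/-- The vectors with entries in `{1, …, r - 1}` and sum divisible by `r`. -/
def positiveResidueVectors (V : Type*) [Fintype V] [DecidableEq V] (r : ℕ) : Finset (V → ℕ) :=
  (Fintype.piFinset fun _ => Finset.Ico 1 r).filter fun s => r ∣ ∑ v, s v

theorem sum_superset_neg_one_pow (A : Finset V) :
    ∑ F : Finset V, (if A ⊆ F then (-1 : ℝ[X]) ^ (Fintype.card V - F.card) else 0) =
      if A = Finset.univ then 1 else 0 := by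
  rw [← (compl_involutive (α := Finset V)).bijective.sum_comp]
  have h := congrArg (Int.cast : ℤ → ℝ[X]) (Finset.sum_powerset_neg_one_pow_card (x := Aᶜ))
  simp only [Int.cast_sum, Int.cast_pow, Int.cast_neg, Int.cast_one, Int.cast_ite, Int.cast_zero,
    Finset.compl_eq_empty_iff] at h
  rw [← h, ← Finset.sum_filter]
  refine Finset.sum_congr ?_ fun F _ => ?_
  · ext F
    simp [Finset.subset_compl_comm]
  · rw [Finset.card_compl, Nat.sub_sub_self (Finset.card_le_univ F)]

/-- The local `h`-polynomial of the `r`-th edgewise subdivision is the section `∑ₖ c_{rk} Xᵏ` of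
the polynomial `(X + ⋯ + X^(r-1))ⁿ = ∑ c_j X^j`. -/
theorem edgewiseLocalHPolynomial_eq {r : ℕ} (hr : 0 < r) :
    edgewiseLocalHPolynomial V r =
      ∑ s ∈ positiveResidueVectors V r, X ^ ((∑ v, s v) / r) := by
  have hres : ∀ F : Finset V, residueVectors r F = (residueVectors r Finset.univ).filter
      fun s => Finset.univ.filter (fun v => s v ≠ 0) ⊆ F := by
    intro F
    ext s
    simp only [Finset.mem_filter, mem_residueVectors, Finset.subset_iff, Finset.mem_univ,
      true_and, implies_true, and_true, and_assoc]
  have hpos : positiveResidueVectors V r = (residueVectors r Finset.univ).filter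
      fun s => Finset.univ.filter (fun v => s v ≠ 0) = Finset.univ := by
    ext s
    simp only [positiveResidueVectors, Finset.mem_filter, mem_residueVectors, Fintype.mem_piFinset,
      Finset.mem_Ico, Finset.filter_eq_self, Finset.mem_univ, implies_true, and_true,
      forall_true_left, forall_and, Nat.one_le_iff_ne_zero, ne_eq]
    tauto
  simp only [edgewiseLocalHPolynomial, localHPolynomial, hPolynomial_carrierRestrict hr,
    residuePolynomial, hpos]
  rw [Finset.sum_congr rfl fun F _ => by rw [hres F]]
  simp only [Finset.sum_filter, Finset.mul_sum]
  -- For a fixed vector `s` the signs now run over the `F` containing its support, and they cancel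
  -- unless that support is all of `V`.
  rw [Finset.sum_comm]
  refine Finset.sum_congr rfl fun s _ => ?_
  have h := congrArg (· * (X : ℝ[X]) ^ ((∑ v, s v) / r))
    (sum_superset_neg_one_pow (Finset.univ.filter fun v => s v ≠ 0))
  simp only [Finset.sum_mul, ite_mul, zero_mul, one_mul] at h
  simp only [mul_ite, mul_zero]
  exact h

theorem aeval_edgewiseLocalHPolynomial {r : ℕ} (hr : 0 < r) (y : ℂ) :
    aeval y (edgewiseLocalHPolynomial V r) =
      (windowSum r)^[Fintype.card V] (dilatedPowers r y) 0 := by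
  rw [edgewiseLocalHPolynomial_eq hr, iterate_windowSum_eq_sum, positiveResidueVectors,
    Finset.sum_filter, map_sum]
  refine Finset.sum_congr rfl fun s _ => ?_
  rw [dilatedPowers, zero_add]
  split_ifs <;> simp

theorem hasOnlyRealZeros_sum_X_pow_of_card_le_one {ι : Type*} {S : Finset ι} (hS : S.card ≤ 1)
    (e : ι → ℕ) : HasOnlyRealZeros (∑ s ∈ S, X ^ e s) := by
  rcases Finset.card_le_one_iff_subsingleton.1 hS |>.eq_empty_or_singleton with h | ⟨a, h⟩
  · rw [Finset.coe_eq_empty] at h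
    exact Or.inl (by rw [h, Finset.sum_empty])
  · rw [Finset.coe_eq_singleton] at h
    refine Or.inr fun z hz => ?_
    rw [h, Finset.sum_singleton, map_pow, aeval_X] at hz
    rw [eq_zero_of_pow_eq_zero hz, Complex.zero_im]

theorem hasOnlyRealZeros_of_forall_im_pos {p : ℝ[X]} (h : ∀ z : ℂ, 0 < z.im → aeval z p ≠ 0) :
    HasOnlyRealZeros p := by
  refine Or.inr fun z hz => ?_
  rcases lt_trichotomy z.im 0 with hlt | h0 | hgt
  · refine absurd ?_ (h (starRingEnd ℂ z) (by simpa using hlt))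
    rw [aeval_conj, hz, map_zero]
  · exact h0
  · exact absurd hz (h z hgt)

end LocalHPolynomial

end

theorem corollary2p5 {V : Type*} [Fintype V] [LinearOrder V] (r : ℕ) (hr : 1 ≤ r) :
    HasOnlyRealZeros (edgewiseLocalHPolynomial V r) := by
  by_cases hn : 2 ≤ Fintype.card V ∧ 3 ≤ r
  · refine hasOnlyRealZeros_of_forall_im_pos fun z hz => ?_
    rw [aeval_edgewiseLocalHPolynomial hr, ← Nat.sub_add_cancel hn.1]
    exact iterate_windowSum_ne_zero hn.2 hz _ _
  -- In the remaining cases at most one vector contributes: for `r ≤ 2` entries in `{1, …, r - 1}`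
  -- can only be `1`, and for a single vertex with `r ≥ 3` no such entry is divisible by `r`.
  rw [edgewiseLocalHPolynomial_eq hr]
  refine hasOnlyRealZeros_sum_X_pow_of_card_le_one ?_ _
  rw [Finset.card_le_one]
  intro s hs t ht
  simp only [positiveResidueVectors, Finset.mem_filter, Fintype.mem_piFinset,
    Finset.mem_Ico] at hs ht
  ext v
  have hsv := hs.1 v
  have htv := ht.1 v
  rcases lt_or_ge r 3 with h3 | h3
  · omega
  have : Subsingleton V := Fintype.card_le_one_iff_subsingleton.1 (by omega)
  have hsum := Fintype.sum_subsingleton s v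
  rw [hsum] at hs
  exact absurd hsv.2 (Nat.le_of_dvd hsv.1 hs.2).not_gt
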